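/- Let $n\ge 0$ be an integer and let $V\subset\mathbb{R}^n$ be the Euclidean space of vectors with coordinate sum $0$, with root system $\Phi_n=\{e_i-e_j : i\neq j\}$. For $\alpha\in\Phi_n$ and $j\in\mathbb{Z}$ let $r_{\alpha,j}$ be the orthogonal reflection of $V$ in the hyperplane $\{v : \langle v,\alpha\rangle=j\}$. Let $R=\{r_{\alpha,j} : \alpha\in\Phi_n,\ j\in\mathbb{Z}\}$, let the affine symmetric group $\widetilde{\mathfrak S}_n$ be the group of isometries of $V$ generated by $R$, and for $w\in\widetilde{\mathfrak S}_n$ let the reflection length $\ell_R(w)$ be the least $k$ such that $w$ is a product of $k$ elements of $R$. For $\lambda\in V$ let $t_\lambda$ be the translation $v\mapsto v+\lambda$, and for $\pi\in\mathfrak S_n$ let $u_\pi(v_1,\dots,v_n)=(v_{\pi(1)},\dots,v_{\pi(n)})$. Let $|\mathrm{cyc}(\pi)|$ be the number of cycles of $\pi$, fixed points included. The move-set of an isometry $w$ of $V$ is $\mathrm{Mov}(w)=\{w(x)-x : x\in V\}$. A root space is a linear subspace of $V$ spanned by roots, and $\dim(w)$ is the least dimension of a root space containing $\mathrm{Mov}(w)$.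 Put $e(w)=\dim(w_e)$, where $w_e$ is the linear part of $w$, and $d(w)=\dim(w)-e(w)$. A null partition of $\lambda\in V$ is a partition of $\{1,\dots,n\}$ into nonempty blocks such that the coordinates of $\lambda$ in each block sum to $0$. The relative nullity $\nu(\lambda/\pi)$ is the largest number of blocks of a null partition of $\lambda$ in which each cycle of $\pi$ lies inside a single block. **Theorem.** Every $w\in\widetilde{\mathfrak S}_n$ has a unique normal form $w=t_\lambda u_\pi$ with $\lambda$ in the $\mathbb{Z}$-span of $\Phi_n$ and $\pi\in\mathfrak S_n$. If $w=t_\lambda u_\pi$ is this normal form, then $$e(w)=n-|\mathrm{cyc}(\pi)|,\qquad d(w)=|\mathrm{cyc}(\pi)|-\nu(\lambda/\pi),$$ $$\ell_R(w)=n-2\,\nu(\lambda/\pi)+|\mathrm{cyc}(\pi)|.$$ -/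

import Mathlib

namespace AffineSymmetric

open scoped InnerProductSpace

noncomputable section

/-- The Euclidean space `V` of vectors in `ℝⁿ` with coordinate sum `0`. -/
def V (n : ℕ) : Submodule ℝ (EuclideanSpace ℝ (Fin n)) where
  carrier := {v | ∑ i, v i = 0}
  zero_mem' := by simp
  add_mem' := by
    intro a b ha hb
    simp only [Set.mem_ofPred_eq] at ha hb ⊢
    simp [Finset.sum_add_distrib, ha, hb]
  smul_mem' := by
    intro c a ha
    simp only [Set.mem_ofPred_eq] at ha ⊢
    simp [← Finset.mul_sum, ha]

/-- The group of isometries of the Euclidean space `V`. -/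
abbrev Isom (n : ℕ) : Type := V n ≃ᵃⁱ[ℝ] V n

/-- The root system `Φₙ = {eᵢ - eⱼ | i ≠ j}`, inside `V`. -/
def roots (n : ℕ) : Set (V n) :=
  {α | ∃ i j : Fin n, i ≠ j ∧
    (α : EuclideanSpace ℝ (Fin n)) = EuclideanSpace.single i 1 - EuclideanSpace.single j 1}

/-- The translation `t_lam : v ↦ v + lam`. -/
def translation {n : ℕ} (lam : V n) : Isom n :=
  AffineIsometryEquiv.constVAdd ℝ (V n) lam

/-- The reflection of `V` across the affine hyperplane `H_{α,j} = {v | ⟪v, α⟫ = j}`, that is,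
`v ↦ v - (⟪v, α⟫ - j) α^∨` with `α^∨ = (2 / ⟪α, α⟫) α`. -/
def affineReflection {n : ℕ} (α : V n) (j : ℤ) : Isom n :=
  translation (((j : ℝ) * (2 / ⟪α, α⟫_ℝ)) • α) *
    ((Submodule.span ℝ {α})ᗮ.reflection).toAffineIsometryEquiv

theorem translation_apply {n : ℕ} (lam v : V n) : translation lam v = lam + v := rfl

theorem affineReflection_apply {n : ℕ} (α : V n) (j : ℤ) (v : V n) :
    affineReflection α j v = v - ((⟪v, α⟫_ℝ - j) * (2 / ⟪α, α⟫_ℝ)) • α := by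
  have h : affineReflection α j v =
      ((j : ℝ) * (2 / ⟪α, α⟫_ℝ)) • α + (Submodule.span ℝ {α})ᗮ.reflection v := rfl
  rw [h, Submodule.reflection_orthogonal_apply, Submodule.reflection_singleton_apply,
    real_inner_self_eq_norm_sq, real_inner_comm]
  simp only [RCLike.ofReal_real_eq_id, id]
  module

/-- The points fixed by `affineReflection α j` are exactly those of the hyperplane `H_{α,j}`. -/
theorem affineReflection_fixed_iff {n : ℕ} {α : V n} (hα : α ≠ 0) (j : ℤ) (v : V n) :
    affineReflection α j v = v ↔ ⟪v, α⟫_ℝ = j := by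
  have h2 : ⟪α, α⟫_ℝ ≠ 0 := inner_self_ne_zero.mpr hα
  rw [affineReflection_apply, sub_eq_self, smul_eq_zero_iff_left hα, mul_eq_zero, sub_eq_zero]
  simp [hα]

/-- The set `R = {r_{α,j} | α ∈ Φₙ, j ∈ ℤ}` of reflections. -/
def reflections (n : ℕ) : Set (Isom n) :=
  {r | ∃ α ∈ roots n, ∃ j : ℤ, r = affineReflection α j}

/-- The affine symmetric group: the group of isometries of `V` generated by `R`. -/
def affineSymmetricGroup (n : ℕ) : Subgroup (Isom n) :=
  Subgroup.closure (reflections n)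

/-- The reflection length `ℓ_R(w)`: the least `k` such that `w` is a product of `k` reflections. -/
def reflectionLength {n : ℕ} (w : affineSymmetricGroup n) : ℕ :=
  sInf {k | ∃ rs : List (Isom n), (∀ r ∈ rs, r ∈ reflections n) ∧ rs.length = k ∧ rs.prod = w}

/-- The elliptic isometry `u_π : (v₁, …, vₙ) ↦ (v_{π(1)}, …, v_{π(n)})`, as a linear isometry
of `V`. -/
def permLinearIsometry {n : ℕ} (π : Equiv.Perm (Fin n)) : V n ≃ₗᵢ[ℝ] V n where
  toFun v := ⟨WithLp.toLp 2 fun i => (v : EuclideanSpace ℝ (Fin n)) (π i),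
    (Equiv.sum_comp π fun i => (v : EuclideanSpace ℝ (Fin n)) i).trans v.2⟩
  invFun v := ⟨WithLp.toLp 2 fun i => (v : EuclideanSpace ℝ (Fin n)) (π.symm i),
    (Equiv.sum_comp π.symm fun i => (v : EuclideanSpace ℝ (Fin n)) i).trans v.2⟩
  map_add' v w := by ext i; simp
  map_smul' c v := by ext i; simp
  left_inv v := by ext i; simp
  right_inv v := by ext i; simp
  norm_map' v := by
    simp only [LinearEquiv.coe_mk, LinearMap.coe_mk, AddHom.coe_mk, Submodule.coe_norm,
      EuclideanSpace.norm_eq]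
    congr 1
    exact Equiv.sum_comp π fun i => ‖(v : EuclideanSpace ℝ (Fin n)) i‖ ^ 2

/-- `u_π` as an isometry of the Euclidean space `V`. -/
def permIsometry {n : ℕ} (π : Equiv.Perm (Fin n)) : Isom n :=
  (permLinearIsometry π).toAffineIsometryEquiv

/-- The (co)root lattice: the `ℤ`-span of `Φₙ`. -/
def rootLattice (n : ℕ) : AddSubgroup (V n) :=
  AddSubgroup.closure (roots n)

/-- `w = t_lam u_π` is the normal form of `w`, where `lam` lies in the root lattice. -/
def IsNormalForm {n : ℕ} (w : affineSymmetricGroup n) (lam : rootLattice n)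
    (π : Equiv.Perm (Fin n)) : Prop :=
  (w : Isom n) = translation (lam : V n) * permIsometry π

/-! ### Dimensions -/

/-- The move-set `Mov(w)` of an isometry. -/
def moveSet {n : ℕ} (w : Isom n) : Set (V n) :=
  {μ | ∃ x : V n, w x = x + μ}

/-- A root space is a linear subspace spanned by the roots it contains. -/
def IsRootSpace {n : ℕ} (U : Submodule ℝ (V n)) : Prop :=
  U = Submodule.span ℝ ((U : Set (V n)) ∩ roots n)

/-- The root dimension of `A`: the least dimension of a root space containing `A`. -/
def rootDim {n : ℕ} (A : Set (V n)) : ℕ :=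
  sInf {k | ∃ U : Submodule ℝ (V n), IsRootSpace U ∧ A ⊆ U ∧ Module.finrank ℝ U = k}

/-- The dimension `dim(w)` of an isometry: the root dimension of its move-set. -/
def isomDim {n : ℕ} (w : Isom n) : ℕ :=
  rootDim (moveSet w)

/-- The elliptic part of `w`: its linear part, the image of `w` under the projection that
sends `r_{α,j}` to `r_α`. -/
def ellipticPart {n : ℕ} (w : Isom n) : Isom n :=
  w.linearIsometryEquiv.toAffineIsometryEquiv

/-- The elliptic dimension `e(w)`. -/
def ellipticDim {n : ℕ} (w : affineSymmetricGroup n) : ℕ :=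
  isomDim (ellipticPart (w : Isom n))

/-- The differential dimension `d(w) = dim(w) - e(w)`, a difference of integers. -/
def differentialDim {n : ℕ} (w : affineSymmetricGroup n) : ℤ :=
  (isomDim (w : Isom n) : ℤ) - ellipticDim w

/-! ### Null partitions -/

open Classical in
/-- The partition `P(π)` of the index set into the cycles of `π`, fixed points included. -/
def cyclePartition {n : ℕ} (π : Equiv.Perm (Fin n)) :
    Finpartition (Finset.univ : Finset (Fin n)) :=
  Finpartition.ofSetoid (Equiv.Perm.SameCycle.setoid π)

/-- The number `|cyc(π)|` of cycles of `π`, fixed points included. -/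
def numCycles {n : ℕ} (π : Equiv.Perm (Fin n)) : ℕ :=
  (cyclePartition π).parts.card

/-- `P` is a null partition of `v`: the coordinates of `v` in each block of `P` sum to `0`. -/
def IsNullPartition {n : ℕ} (v : V n) (P : Finpartition (Finset.univ : Finset (Fin n))) : Prop :=
  ∀ B ∈ P.parts, ∑ i ∈ B, (v : EuclideanSpace ℝ (Fin n)) i = 0

/-- The relative nullity `ν(v/π)`: the maximal size of a null partition of `v` such that every
cycle of `π` is contained in a single block. -/
def relativeNullity {n : ℕ} (v : V n) (π : Equiv.Perm (Fin n)) : ℕ :=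
  sSup {k | ∃ P : Finpartition (Finset.univ : Finset (Fin n)),
    IsNullPartition v P ∧ (∀ C ∈ (cyclePartition π).parts, ∃ B ∈ P.parts, C ⊆ B) ∧
      P.parts.card = k}

end

end AffineSymmetric

namespace AffineSymmetric

open scoped InnerProductSpace
open Equiv

/-! ### Counting the classes of a setoid -/

/-! Everything is encoded by equivalence relations `s` on the indices. Call `s` admissible for `t_λ
u_π` if `λ` sums to zero on each class (`Null`) and `cyc π ≤ s`; then `ν(λ/π)` is the largest number
of classes of an admissible `s`.

Length: left multiplication by a reflection changes `λ` by a multiple of `e_i - e_j` and `π` to `π *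
swap i j` (`affineReflection_mul_normalForm`), which merges or splits cycles. Following an
admissible `s` along a word gives `n + |cyc π| ≤ length + 2|s|`, hence the lower bound
(`exists_normalForm_of_prod`). Conversely, from any admissible `s`, cycles inside a block are merged
until `cyc π = s`; then fixed points with zero coordinate are split off until the identity is
reached. Each step saves exactly one in the inequality (`exists_split`,
`exists_prod_of_normalForm`).

Dimension: root spaces are exactly the spaces `nullSpace s`, of dimension `n - |s|`, and `nullSpace
s` contains the move-set iff `s` is admissible (`moveSet_subset_iff`). So `dim(w) = n - ν(λ/π)`. The
elliptic part has `λ = 0`, for which `cyc π` itself is optimal. -/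

/-- The number of classes of a setoid. -/
noncomputable def numClasses {n : ℕ} (s : Setoid (Fin n)) : ℕ := Nat.card (Quotient s)

theorem numClasses_ker {n : ℕ} {β : Type*} (f : Fin n → β) :
    numClasses (Setoid.ker f) = (Set.range f).ncard := by
  rw [numClasses, Nat.card_congr (Setoid.quotientKerEquivRange f), Nat.card_coe_set_eq]

theorem numClasses_bot (n : ℕ) : numClasses (⊥ : Setoid (Fin n)) = n := by
  have h : (⊥ : Setoid (Fin n)) = Setoid.ker id := by
    ext a b; simp [Setoid.ker_def]
  rw [h, numClasses_ker]
  simp [Set.ncard_univ]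

theorem numClasses_anti {n : ℕ} {s t : Setoid (Fin n)} (h : s ≤ t) :
    numClasses t ≤ numClasses s :=
  Nat.card_le_card_of_surjective (Quotient.map' id fun _ _ hab => h hab)
    (fun q => q.inductionOn fun a => ⟨Quotient.mk s a, rfl⟩)

theorem numClasses_le {n : ℕ} (s : Setoid (Fin n)) : numClasses s ≤ n :=
  (numClasses_anti bot_le).trans_eq (numClasses_bot n)

/-- Relabelling the class of `j` as that of `i` gives a map on indices that misses exactly one
class. Minimality of its kernel `t` later identifies `t` with a cycle relation. -/
theorem exists_merge {n : ℕ} (s : Setoid (Fin n)) {i j : Fin n} (h : ¬ s i j) :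
    ∃ t : Setoid (Fin n), s ≤ t ∧ t i j ∧ (∀ u : Setoid (Fin n), s ≤ u → u i j → t ≤ u) ∧
      numClasses t + 1 = numClasses s := by
  classical
  have hne : Quotient.mk s i ≠ Quotient.mk s j := fun he => h (Quotient.exact he)
  set f : Fin n → Quotient s := fun x =>
    if Quotient.mk s x = Quotient.mk s j then Quotient.mk s i else Quotient.mk s x with hf
  refine ⟨Setoid.ker f, ?_, ?_, ?_, ?_⟩
  · intro a b hab
    have : Quotient.mk s a = Quotient.mk s b := Quotient.sound hab
    simp [Setoid.ker_def, hf, this]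
  · simp [Setoid.ker_def, hf]
  · intro u hsu huij a b hab
    have key : ∀ x y, f x = Quotient.mk s y → u x y := by
      intro x y hxy
      by_cases hx : Quotient.mk s x = Quotient.mk s j
      · simp only [hf, hx, if_true] at hxy
        exact u.trans (hsu (Quotient.exact hx))
          (u.trans (u.symm huij) (hsu (Quotient.exact hxy)))
      · simp only [hf, hx, if_false] at hxy
        exact hsu (Quotient.exact hxy)
    obtain ⟨y, hy⟩ := Quotient.exists_rep (f a)
    exact u.trans (key a y hy.symm) (u.symm (key b y ((Setoid.ker_def.1 hab).symm.trans hy.symm)))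
  · have hr : Set.range f = {Quotient.mk s j}ᶜ := by
      ext q
      constructor
      · rintro ⟨x, rfl⟩
        by_cases hx : Quotient.mk s x = Quotient.mk s j <;> simp [hf, hx, hne]
      · intro hq
        obtain ⟨y, rfl⟩ := Quotient.exists_rep q
        exact ⟨y, if_neg hq⟩
    rw [numClasses_ker, hr, Set.ncard_compl, Set.ncard_singleton, numClasses]
    have : 0 < Nat.card (Quotient s) := @Nat.card_pos _ ⟨Quotient.mk s i⟩ _
    omega

/-! ### Cycles of a permutation times a transposition -/

/-- The setoid of cycles of a permutation. -/
abbrev cyc {n : ℕ} (π : Perm (Fin n)) : Setoid (Fin n) := Perm.SameCycle.setoid π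

theorem cyc_apply {n : ℕ} {π : Perm (Fin n)} {a b : Fin n} : cyc π a b ↔ π.SameCycle a b :=
  Iff.rfl

/-- By finiteness, points of one cycle are joined by nonnegative powers of `π`, so single steps
suffice. -/
theorem cyc_le_iff {n : ℕ} {π : Perm (Fin n)} {u : Setoid (Fin n)} :
    cyc π ≤ u ↔ ∀ a, u (π a) a := by
  constructor
  · intro h a
    exact h (cyc_apply.2 (Perm.sameCycle_apply_left.2 (Perm.SameCycle.refl π a)))
  · intro h a b hab
    obtain ⟨k, hk⟩ := (cyc_apply.1 hab).exists_nat_pow_eq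
    subst hk
    induction k with
    | zero => exact u.refl a
    | succ k ih =>
      rw [pow_succ', Perm.mul_apply]
      exact u.trans (ih ⟨k, by simp⟩) (u.symm (h _))

theorem cyc_one {n : ℕ} : cyc (1 : Perm (Fin n)) = ⊥ :=
  le_bot_iff.1 (cyc_le_iff.2 fun _ => rfl)

theorem cyc_mul_swap_le {n : ℕ} {π : Perm (Fin n)} {u : Setoid (Fin n)} {i j : Fin n}
    (h : cyc π ≤ u) (hij : u i j) : cyc (π * swap i j) ≤ u := by
  rw [cyc_le_iff] at h ⊢
  intro a
  rw [Perm.mul_apply]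
  refine u.trans (h _) ?_
  rcases eq_or_ne a i with rfl | hi
  · rw [swap_apply_left]; exact u.symm hij
  rcases eq_or_ne a j with rfl | hj
  · rw [swap_apply_right]; exact hij
  · rw [swap_apply_of_ne_of_ne hi hj]

/-- The new permutation sends `j` to `π i` and then follows the `π`-cycle of `i`, which avoids `j`,
until it returns to `i`. -/
theorem cyc_mul_swap_of_not {n : ℕ} {π : Perm (Fin n)} {i j : Fin n} (h : ¬ cyc π i j) :
    cyc (π * swap i j) i j := by
  set σ := π * swap i j with hσ
  by_contra hc
  have hij : i ≠ j := by rintro rfl; exact h ((cyc π).refl i)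
  have hσj : σ j = π i := by simp [hσ]
  have hstep : ∀ k : ℕ, cyc σ j ((π ^ (k + 1)) i) := by
    intro k
    induction k with
    | zero =>
      rw [zero_add, pow_one, ← hσj]
      exact (cyc σ).symm (cyc_le_iff.1 le_rfl j)
    | succ k ih =>
      set x := (π ^ (k + 1)) i with hx
      have hxj : x ≠ j := fun he => h ⟨(k + 1 : ℕ), by rw [zpow_natCast, ← hx, he]⟩
      have hxi : x ≠ i := by
        intro he
        rw [he] at ih
        exact hc ((cyc σ).symm ih)
      have : (π ^ (k + 1 + 1)) i = σ x := by
        rw [pow_succ', Perm.mul_apply, hσ, Perm.mul_apply, swap_apply_of_ne_of_ne hxi hxj]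
      rw [this]
      exact (cyc σ).trans ih ((cyc σ).symm (cyc_le_iff.1 le_rfl x))
  -- At exponent `orderOf π` the orbit is back at `i`, so `j` and `i` share a cycle after all.
  have h1 := hstep (orderOf π - 1)
  rw [Nat.sub_add_cancel (orderOf_pos π), pow_orderOf_eq_one] at h1
  exact hc ((cyc σ).symm h1)

theorem numClasses_cyc_mul_swap_of_not {n : ℕ} {π : Perm (Fin n)} {i j : Fin n}
    (h : ¬ cyc π i j) : numClasses (cyc (π * swap i j)) + 1 = numClasses (cyc π) := by
  obtain ⟨t, hst, htij, hmin, hcard⟩ := exists_merge (cyc π) h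
  have hle : cyc π ≤ cyc (π * swap i j) := by
    have := cyc_mul_swap_le (π := π * swap i j) le_rfl (cyc_mul_swap_of_not h)
    rwa [mul_assoc, swap_mul_self, mul_one] at this
  rwa [le_antisymm (cyc_mul_swap_le hst htij) (hmin _ hle (cyc_mul_swap_of_not h))]

/-- Multiplying by the swap again recovers `π`, so a split is a merge read backwards. -/
theorem numClasses_cyc_mul_swap_le {n : ℕ} (π : Perm (Fin n)) (i j : Fin n) :
    numClasses (cyc (π * swap i j)) ≤ numClasses (cyc π) + 1 := by
  by_cases h : cyc (π * swap i j) i j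
  · have := cyc_mul_swap_le (π := π * swap i j) le_rfl h
    rw [mul_assoc, swap_mul_self, mul_one] at this
    by_cases h' : cyc π i j
    · have h2 := cyc_mul_swap_le (π := π) le_rfl h'
      rw [le_antisymm h2 this]; omega
    · have := numClasses_cyc_mul_swap_of_not h'
      omega
  · have := numClasses_cyc_mul_swap_of_not h
    rw [mul_assoc, swap_mul_self, mul_one] at this
    omega

/-! ### Partitions and setoids -/

theorem numClasses_ker_part {n : ℕ} (P : Finpartition (Finset.univ : Finset (Fin n))) :
    numClasses (Setoid.ker P.part) = P.parts.card := by
  rw [numClasses_ker, ← Set.ncard_coe_finset]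
  congr 1
  ext B
  constructor
  · rintro ⟨a, rfl⟩
    exact P.part_mem.2 (Finset.mem_univ a)
  · intro hB
    obtain ⟨a, ha⟩ := P.nonempty_of_mem_parts hB
    exact ⟨a, P.part_eq_of_mem hB ha⟩

open Classical in
theorem ker_part_ofSetoid {n : ℕ} (s : Setoid (Fin n)) :
    Setoid.ker (Finpartition.ofSetoid s).part = s := by
  ext a b
  rw [Setoid.ker_def, ← Finpartition.mem_part_iff_part_eq_part _ (Finset.mem_univ _)
    (Finset.mem_univ _), Finpartition.mem_part_ofSetoid_iff_rel]
  exact ⟨s.symm, s.symm⟩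

theorem numCycles_eq {n : ℕ} (π : Perm (Fin n)) : numCycles π = numClasses (cyc π) := by
  rw [numCycles, cyclePartition, ← numClasses_ker_part, ker_part_ofSetoid]

/-- `v` pairs to zero with every function constant on the classes of `s`; equivalently, its
coordinates sum to zero on each class. -/
def Null {n : ℕ} (v : V n) (s : Setoid (Fin n)) : Prop :=
  ∀ g : Fin n → ℝ, (∀ a b, s a b → g a = g b) →
    ∑ i, (v : EuclideanSpace ℝ (Fin n)) i * g i = 0

/-- Block indicators are test functions constant on blocks; conversely such a test function factors
out of each block sum. -/
theorem isNullPartition_iff {n : ℕ} (v : V n)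
    (P : Finpartition (Finset.univ : Finset (Fin n))) :
    IsNullPartition v P ↔ Null v (Setoid.ker P.part) := by
  classical
  constructor
  · intro h g hg
    rw [← P.biUnion_parts, Finset.sum_biUnion (P.supIndep.pairwiseDisjoint)]
    refine Finset.sum_eq_zero fun B hB => ?_
    obtain ⟨b, hb⟩ := P.nonempty_of_mem_parts hB
    have : ∀ i ∈ B, (v : EuclideanSpace ℝ (Fin n)) i * g i =
        (v : EuclideanSpace ℝ (Fin n)) i * g b := fun i hi => by
      rw [hg i b ((P.part_eq_of_mem hB hi).trans (P.part_eq_of_mem hB hb).symm)]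
    simp only [id]
    rw [Finset.sum_congr rfl this, ← Finset.sum_mul, h B hB, zero_mul]
  · intro h B hB
    have := h (fun i => if P.part i = B then 1 else 0) (fun a b hab => by
      rw [Setoid.ker_def.1 hab])
    simp only [mul_ite, mul_one, mul_zero, ← Finset.sum_filter] at this
    rw [← this]
    congr 1
    ext i
    simp only [Finset.mem_filter, Finset.mem_univ, true_and]
    constructor
    · intro hi; exact P.part_eq_of_mem hB hi
    · rintro rfl; exact P.mem_part (Finset.mem_univ i)

theorem cyclePartition_refines_iff {n : ℕ} (π : Perm (Fin n))
    (P : Finpartition (Finset.univ : Finset (Fin n))) :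
    (∀ C ∈ (cyclePartition π).parts, ∃ B ∈ P.parts, C ⊆ B) ↔ cyc π ≤ Setoid.ker P.part := by
  have hk : Setoid.ker (cyclePartition π).part = cyc π := ker_part_ofSetoid _
  rw [← hk]
  constructor
  · intro h a b hab
    obtain ⟨B, hB, hCB⟩ := h _ ((cyclePartition π).part_mem.2 (Finset.mem_univ a))
    have ha := hCB ((cyclePartition π).mem_part (Finset.mem_univ a))
    have hb : b ∈ B := by
      refine hCB ?_
      rw [Setoid.ker_def.1 hab]
      exact (cyclePartition π).mem_part (Finset.mem_univ b)
    exact (P.part_eq_of_mem hB ha).trans (P.part_eq_of_mem hB hb).symm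
  · intro h C hC
    obtain ⟨a, ha⟩ := (cyclePartition π).nonempty_of_mem_parts hC
    refine ⟨P.part a, P.part_mem.2 (Finset.mem_univ a), fun b hb => ?_⟩
    have : (cyclePartition π).part a = (cyclePartition π).part b :=
      ((cyclePartition π).part_eq_of_mem hC ha).trans
        ((cyclePartition π).part_eq_of_mem hC hb).symm
    have := h (Setoid.ker_def.2 this)
    rw [Setoid.ker_def.1 this]
    exact P.mem_part (Finset.mem_univ b)

theorem relativeNullity_eq {n : ℕ} (v : V n) (π : Perm (Fin n)) :
    relativeNullity v π =
      sSup {k | ∃ s : Setoid (Fin n), Null v s ∧ cyc π ≤ s ∧ numClasses s = k} := by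
  rw [relativeNullity]
  congr 1
  ext k
  constructor
  · rintro ⟨P, h1, h2, rfl⟩
    exact ⟨Setoid.ker P.part, (isNullPartition_iff v P).1 h1,
      (cyclePartition_refines_iff π P).1 h2, numClasses_ker_part P⟩
  · classical
    rintro ⟨s, h1, h2, rfl⟩
    refine ⟨Finpartition.ofSetoid s, ?_, ?_, ?_⟩
    · rwa [isNullPartition_iff, ker_part_ofSetoid]
    · rwa [cyclePartition_refines_iff, ker_part_ofSetoid]
    · rw [← numClasses_ker_part, ker_part_ofSetoid]

/-- The total sum of `v` is zero; this makes the set defining the nullity nonempty. -/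
theorem null_top {n : ℕ} (v : V n) : Null v ⊤ := by
  intro g hg
  rcases isEmpty_or_nonempty (Fin n) with h | h
  · simp
  · obtain ⟨a⟩ := h
    have hv : ∑ i, (v : EuclideanSpace ℝ (Fin n)) i = 0 := v.2
    rw [Finset.sum_congr rfl fun i _ => by rw [hg i a trivial], ← Finset.sum_mul, hv, zero_mul]

theorem numClasses_le_relativeNullity {n : ℕ} {v : V n} {π : Perm (Fin n)}
    {s : Setoid (Fin n)} (h : Null v s) (hs : cyc π ≤ s) :
    numClasses s ≤ relativeNullity v π := by
  rw [relativeNullity_eq]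
  exact le_csSup ⟨n, by rintro _ ⟨s, -, -, rfl⟩; exact numClasses_le s⟩ ⟨s, h, hs, rfl⟩

theorem exists_numClasses_eq_relativeNullity {n : ℕ} (v : V n) (π : Perm (Fin n)) :
    ∃ s : Setoid (Fin n), Null v s ∧ cyc π ≤ s ∧ numClasses s = relativeNullity v π := by
  rw [relativeNullity_eq]
  exact Nat.sSup_mem
    (s := {k | ∃ s : Setoid (Fin n), Null v s ∧ cyc π ≤ s ∧ numClasses s = k}) ⟨_, ⊤, null_top v, le_top, rfl⟩
    ⟨n, fun _ ⟨s, _, _, hs⟩ => hs ▸ numClasses_le s⟩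

theorem relativeNullity_zero {n : ℕ} (π : Perm (Fin n)) :
    relativeNullity (0 : V n) π = numClasses (cyc π) := by
  refine le_antisymm ?_ (numClasses_le_relativeNullity (fun g _ => by simp) le_rfl)
  obtain ⟨s, -, hs, h⟩ := exists_numClasses_eq_relativeNullity (0 : V n) π
  rw [← h]
  exact numClasses_anti hs

/-! ### Roots, reflections and normal forms in coordinates -/

/-- The vector `eᵢ - eⱼ` of `V`. -/
noncomputable def rootVec {n : ℕ} (i j : Fin n) : V n :=
  ⟨EuclideanSpace.single i 1 - EuclideanSpace.single j 1, by
    change ∑ x,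
      (EuclideanSpace.single i (1 : ℝ) - EuclideanSpace.single j 1 : EuclideanSpace ℝ (Fin n)) x = 0
    simp⟩

theorem rootVec_apply {n : ℕ} (i j x : Fin n) :
    (rootVec i j : EuclideanSpace ℝ (Fin n)) x =
      (if x = i then 1 else 0) - (if x = j then 1 else 0) := by
  simp [rootVec, PiLp.single_apply]

theorem rootVec_mem_roots {n : ℕ} {i j : Fin n} (h : i ≠ j) : rootVec i j ∈ roots n :=
  ⟨i, j, h, rfl⟩

theorem mem_roots_iff {n : ℕ} {α : V n} : α ∈ roots n ↔ ∃ i j : Fin n, i ≠ j ∧ α = rootVec i j :=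
  ⟨fun ⟨i, j, h, e⟩ => ⟨i, j, h, Subtype.ext e⟩, fun ⟨_, _, h, e⟩ => e ▸ rootVec_mem_roots h⟩

theorem sum_rootVec_mul {n : ℕ} (i j : Fin n) (g : Fin n → ℝ) :
    ∑ x, (rootVec i j : EuclideanSpace ℝ (Fin n)) x * g x = g i - g j := by
  simp [rootVec_apply, sub_mul]

theorem inner_eq_sum {n : ℕ} (v w : V n) : ⟪v, w⟫_ℝ =
    ∑ x, (w : EuclideanSpace ℝ (Fin n)) x * (v : EuclideanSpace ℝ (Fin n)) x := by
  simp [Submodule.coe_inner, PiLp.inner_apply]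

theorem inner_rootVec {n : ℕ} (v : V n) (i j : Fin n) :
    ⟪v, rootVec i j⟫_ℝ = (v : EuclideanSpace ℝ (Fin n)) i - (v : EuclideanSpace ℝ (Fin n)) j := by
  rw [inner_eq_sum, sum_rootVec_mul]

theorem affineReflection_rootVec {n : ℕ} {i j : Fin n} (h : i ≠ j) (k : ℤ) (v : V n) :
    affineReflection (rootVec i j) k v = v - ((v : EuclideanSpace ℝ (Fin n)) i -
      (v : EuclideanSpace ℝ (Fin n)) j - k) • rootVec i j := by
  have h2 : ⟪rootVec i j, rootVec i j⟫_ℝ = 2 := by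
    rw [inner_rootVec, rootVec_apply, rootVec_apply]
    simp [h, h.symm]; norm_num
  rw [affineReflection_apply, h2, inner_rootVec]
  simp

theorem affineReflection_mem {n : ℕ} {i j : Fin n} (h : i ≠ j) (k : ℤ) :
    affineReflection (rootVec i j) k ∈ reflections n :=
  ⟨_, rootVec_mem_roots h, k, rfl⟩

theorem mem_reflections_iff {n : ℕ} {r : Isom n} : r ∈ reflections n ↔
    ∃ i j : Fin n, i ≠ j ∧ ∃ k : ℤ, r = affineReflection (rootVec i j) k := by
  constructor
  · rintro ⟨α, hα, k, rfl⟩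
    obtain ⟨i, j, h, rfl⟩ := mem_roots_iff.1 hα
    exact ⟨i, j, h, k, rfl⟩
  · rintro ⟨i, j, h, k, rfl⟩
    exact affineReflection_mem h k

theorem isom_mul_apply {n : ℕ} (f g : Isom n) (v : V n) : (f * g) v = f (g v) := rfl

theorem isom_one_apply {n : ℕ} (v : V n) : (1 : Isom n) v = v := rfl

theorem affineReflection_mul_self {n : ℕ} {i j : Fin n} (h : i ≠ j) (k : ℤ) :
    affineReflection (rootVec i j) k * affineReflection (rootVec i j) k = 1 := by
  ext v x
  rw [isom_mul_apply]
  simp only [affineReflection_rootVec h, isom_one_apply]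
  simp only [Submodule.coe_sub, Submodule.coe_smul, PiLp.sub_apply, PiLp.smul_apply,
    rootVec_apply, smul_eq_mul, if_true, if_neg h, if_neg h.symm]
  ring

theorem normalForm_apply {n : ℕ} (lam : V n) (π : Perm (Fin n)) (v : V n) (x : Fin n) :
    ((translation lam * permIsometry π) v : EuclideanSpace ℝ (Fin n)) x =
      (lam : EuclideanSpace ℝ (Fin n)) x + (v : EuclideanSpace ℝ (Fin n)) (π x) :=
  rfl

theorem translation_zero_mul_permIsometry_one (n : ℕ) :
    translation (0 : V n) * permIsometry 1 = 1 := by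
  ext v x
  rw [normalForm_apply]
  simp

/-- Left multiplication of a normal form by a reflection. -/
theorem affineReflection_mul_normalForm {n : ℕ} {i j : Fin n} (h : i ≠ j) (k : ℤ) (lam : V n)
    (π : Perm (Fin n)) :
    affineReflection (rootVec i j) k * (translation lam * permIsometry π) =
      translation (lam + ((k : ℝ) - (lam : EuclideanSpace ℝ (Fin n)) i +
        (lam : EuclideanSpace ℝ (Fin n)) j) • rootVec i j) * permIsometry (π * swap i j) := by
  ext v x
  rw [isom_mul_apply, affineReflection_rootVec h, normalForm_apply]
  simp only [Submodule.coe_sub, Submodule.coe_add, Submodule.coe_smul, PiLp.sub_apply,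
    PiLp.add_apply, PiLp.smul_apply, rootVec_apply, smul_eq_mul, normalForm_apply,
    Perm.mul_apply]
  rcases eq_or_ne x i with rfl | hi
  · simp [h]; ring
  rcases eq_or_ne x j with rfl | hj
  · simp [h.symm]; ring
  · simp [hi, hj, swap_apply_of_ne_of_ne hi hj]

theorem normalForm_injective {n : ℕ} {lam mu : V n} {π σ : Perm (Fin n)}
    (h : translation lam * permIsometry π = translation mu * permIsometry σ) :
    lam = mu ∧ π = σ := by
  have happ : ∀ v : V n, ∀ x, (lam : EuclideanSpace ℝ (Fin n)) x +
      (v : EuclideanSpace ℝ (Fin n)) (π x) = (mu : EuclideanSpace ℝ (Fin n)) x +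
        (v : EuclideanSpace ℝ (Fin n)) (σ x) := fun v x => by
    rw [← normalForm_apply, ← normalForm_apply, h]
  have h0 : lam = mu := by
    ext x
    simpa using happ 0 x
  refine ⟨h0, Equiv.ext fun x => ?_⟩
  by_contra hne
  -- This vector has coordinate `1` at `π x` and `-1` at `σ x`, so it separates the two
  -- permutations.
  have := happ (rootVec (π x) (σ x)) x
  rw [h0, add_right_inj, rootVec_apply, rootVec_apply] at this
  simp [hne, Ne.symm hne] at this
  norm_num at this

/-! ### The root lattice and existence of normal forms -/

/-- Integrality keeps `λ` in the lattice after a reflection, and lets a coordinate serve as the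
offset of a hyperplane. -/
theorem exists_int_of_mem_rootLattice {n : ℕ} {v : V n} (h : v ∈ rootLattice n) (x : Fin n) :
    ∃ m : ℤ, (v : EuclideanSpace ℝ (Fin n)) x = m := by
  induction h using AddSubgroup.closure_induction with
  | mem α hα =>
    obtain ⟨i, j, -, rfl⟩ := mem_roots_iff.1 hα
    refine ⟨(if x = i then 1 else 0) - (if x = j then 1 else 0), ?_⟩
    rw [rootVec_apply]; push_cast; rfl
  | zero => exact ⟨0, by simp⟩
  | add v w _ _ hv hw =>
    obtain ⟨a, ha⟩ := hv
    obtain ⟨b, hb⟩ := hw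
    exact ⟨a + b, by simp [ha, hb]⟩
  | neg v _ hv =>
    obtain ⟨a, ha⟩ := hv
    exact ⟨-a, by simp [ha]⟩

theorem add_smul_rootVec_mem {n : ℕ} {lam : V n} (hl : lam ∈ rootLattice n) {i j : Fin n}
    (h : i ≠ j) (k : ℤ) :
    lam + ((k : ℝ) - (lam : EuclideanSpace ℝ (Fin n)) i +
        (lam : EuclideanSpace ℝ (Fin n)) j) • rootVec i j ∈ rootLattice n := by
  obtain ⟨a, ha⟩ := exists_int_of_mem_rootLattice hl i
  obtain ⟨b, hb⟩ := exists_int_of_mem_rootLattice hl j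
  have : ((k : ℝ) - a + b) • rootVec i j = (k - a + b : ℤ) • rootVec i j := by
    rw [← Int.cast_smul_eq_zsmul ℝ]; push_cast; rfl
  rw [ha, hb, this]
  exact add_mem hl (zsmul_mem (AddSubgroup.subset_closure (rootVec_mem_roots h)) _)

/-! ### Null partitions along a product of reflections: both bounds on the length. -/

theorem null_add_smul_rootVec {n : ℕ} {lam : V n} {s : Setoid (Fin n)} (hs : Null lam s)
    {i j : Fin n} (h : s i j) (c : ℝ) : Null (lam + c • rootVec i j) s := by
  intro g hg
  simp only [Submodule.coe_add, Submodule.coe_smul, PiLp.add_apply, PiLp.smul_apply, smul_eq_mul,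
    add_mul, mul_assoc, Finset.sum_add_distrib, ← Finset.mul_sum]
  rw [sum_rootVec_mul, hs g hg, hg i j h]
  ring

theorem Null.mono {n : ℕ} {v : V n} {s t : Setoid (Fin n)} (hs : Null v s) (h : s ≤ t) :
    Null v t :=
  fun g hg => hs g fun a b hab => hg a b (h hab)

/-- A product of reflections has a normal form, with a null partition bounding the number of
factors from below. -/
theorem exists_normalForm_of_prod {n : ℕ} (rs : List (Isom n)) (hrs : ∀ r ∈ rs, r ∈ reflections n) :
    ∃ lam ∈ rootLattice n, ∃ π : Perm (Fin n), rs.prod = translation lam * permIsometry π ∧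
      ∃ s, Null lam s ∧ cyc π ≤ s ∧ n + numClasses (cyc π) ≤ rs.length + 2 * numClasses s := by
  induction rs with
  | nil =>
    refine ⟨0, zero_mem _, 1, (translation_zero_mul_permIsometry_one n).symm, ⊥,
      fun g _ => by simp, cyc_one.le, ?_⟩
    rw [cyc_one, numClasses_bot, List.length_nil]
    omega
  | cons r rs ih =>
    obtain ⟨lam, hl, π, hprod, s, hnull, hle, hcard⟩ :=
      ih fun r hr => hrs r (List.mem_cons_of_mem _ hr)
    obtain ⟨i, j, hij, k, rfl⟩ := mem_reflections_iff.1 (hrs r List.mem_cons_self)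
    refine ⟨_, add_smul_rootVec_mem hl hij k, π * swap i j, ?_, ?_⟩
    · rw [List.prod_cons, hprod, affineReflection_mul_normalForm hij]
    · rw [List.length_cons]
      -- If `s` already joins `i` and `j`, keep it: the at most one extra cycle is paid for by the
      -- new factor. Otherwise `s` and `cyc π` each lose one class, and both sides of the inequality
      -- drop by one.
      by_cases hs : s i j
      · refine ⟨s, null_add_smul_rootVec hnull hs _, cyc_mul_swap_le hle hs, ?_⟩
        have := numClasses_cyc_mul_swap_le π i j
        omega
      · obtain ⟨t, hst, htij, -, ht⟩ := exists_merge s hs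
        refine ⟨t, null_add_smul_rootVec (hnull.mono hst) htij _,
          cyc_mul_swap_le (hle.trans hst) htij, ?_⟩
        have := numClasses_cyc_mul_swap_of_not fun hc : cyc π i j => hs (hle hc)
        omega

/-- If every cycle of `π` has sum zero and `π ≠ 1`, some reflection splits a cycle of `π` into two
cycles with sum zero. -/
theorem exists_split {n : ℕ} {lam : V n} (hl : lam ∈ rootLattice n) {π : Perm (Fin n)}
    (hnull : Null lam (cyc π)) (hπ : π ≠ 1) :
    ∃ i j : Fin n, i ≠ j ∧ ∃ k : ℤ,
      Null (lam + ((k : ℝ) - (lam : EuclideanSpace ℝ (Fin n)) i +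
        (lam : EuclideanSpace ℝ (Fin n)) j) • rootVec i j) (cyc (π * swap i j)) ∧
      numClasses (cyc π) + 1 = numClasses (cyc (π * swap i j)) := by
  obtain ⟨i, hi⟩ : ∃ i, π i ≠ i := by
    by_contra! h
    exact hπ (Equiv.ext h)
  -- With `j` the preimage of `i`, the permutation `π * swap i j` fixes `i`: the split-off cycle is
  -- a single point.
  obtain ⟨j, hj⟩ := π.surjective i
  have hij : i ≠ j := by rintro rfl; exact hi hj
  obtain ⟨m, hm⟩ := exists_int_of_mem_rootLattice hl j
  set σ := π * swap i j with hσ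
  have hσi : σ i = i := by simp [hσ, hj]
  have hσπ : σ * swap i j = π := by rw [hσ, mul_assoc, swap_mul_self, mul_one]
  have hnot : ¬ cyc σ i j := fun h => hij ((cyc_apply.1 h).eq_of_left hσi)
  have hπij : cyc π i j := by
    rw [← hσπ]
    exact cyc_mul_swap_of_not hnot
  -- The new coordinate at `i` is `k + λ_j`, so `k = -λ_j` makes it zero.
  refine ⟨i, j, hij, -m, ?_, ?_⟩
  · have hnull' := null_add_smul_rootVec hnull hπij ((-m : ℤ) -
      (lam : EuclideanSpace ℝ (Fin n)) i + (lam : EuclideanSpace ℝ (Fin n)) j)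
    set mu := lam + (((-m : ℤ) : ℝ) - (lam : EuclideanSpace ℝ (Fin n)) i +
      (lam : EuclideanSpace ℝ (Fin n)) j) • rootVec i j with hmu
    have hmui : (mu : EuclideanSpace ℝ (Fin n)) i = 0 := by
      rw [hmu]
      simp [rootVec_apply, hij, hm]
      ring
    intro g hg
    -- Changing `g` at `i` to the value `g j` makes it constant on the cycles of `π`. The pairing is
    -- unaffected, since the new vector vanishes at `i`.
    set h : Fin n → ℝ := fun x => if x = i then g j else g x with hh
    have hle : cyc π ≤ Setoid.ker h := by
      rw [← hσπ]
      refine cyc_mul_swap_le (cyc_le_iff.2 fun a => ?_) (by simp [Setoid.ker_def, hh])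
      rw [Setoid.ker_def]
      rcases eq_or_ne a i with rfl | ha
      · rw [hσi]
      · have : σ a ≠ i := fun he => ha (σ.injective (he.trans hσi.symm))
        simp only [hh, if_neg ha, if_neg this]
        exact hg _ _ (cyc_le_iff.1 le_rfl a)
    rw [← hnull' h fun a b hab => hle hab]
    refine Finset.sum_congr rfl fun x _ => ?_
    rcases eq_or_ne x i with rfl | hx
    · rw [hmui, zero_mul, zero_mul]
    · simp only [hh, if_neg hx]
  · rw [← numClasses_cyc_mul_swap_of_not hnot, hσπ]

theorem Null.eq_zero {n : ℕ} {v : V n} (h : Null v ⊥) : v = 0 := by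
  ext x
  have := h (fun y => if y = x then 1 else 0) (fun a b hab => by
    rw [show a = b from hab])
  simpa using this

/-- A normal form with a null partition factors into few reflections. -/
theorem exists_prod_of_normalForm {n : ℕ} (N : ℕ) {lam : V n} (hl : lam ∈ rootLattice n)
    (π : Perm (Fin n)) (s : Setoid (Fin n)) (hnull : Null lam s) (hle : cyc π ≤ s)
    (hN : n + numClasses (cyc π) = N + 2 * numClasses s) :
    ∃ rs : List (Isom n), (∀ r ∈ rs, r ∈ reflections n) ∧ rs.length = N ∧
      rs.prod = translation lam * permIsometry π := by
  induction N generalizing lam π s with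
  | zero =>
    -- For `N = 0`, the bounds `|s| ≤ |cyc π|` and `|s| ≤ n` must be equalities. A split would give
    -- more than `n` cycles, and a pair of cycles in one block would make the first bound strict.
    have hπ : π = 1 := by
      by_contra hπ
      have hs := numClasses_le s
      by_cases hcs : cyc π = s
      · subst hcs
        obtain ⟨i, j, -, k, -, hk⟩ := exists_split hl hnull hπ
        have := numClasses_le (cyc (π * swap i j))
        omega
      · obtain ⟨i, j, hij, hnot⟩ : ∃ i j, s i j ∧ ¬ cyc π i j := by
          by_contra! h
          exact hcs (le_antisymm hle fun a b hab => h a b hab)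
        have h1 := numClasses_cyc_mul_swap_of_not hnot
        have h2 := numClasses_anti (cyc_mul_swap_le hle hij)
        omega
    subst hπ
    have hs : s = ⊥ := by
      by_contra hne
      obtain ⟨i, j, hij, hnot⟩ : ∃ i j, s i j ∧ ¬ cyc (1 : Perm (Fin n)) i j := by
        by_contra! h
        rw [cyc_one] at h
        exact hne (le_bot_iff.1 fun a b hab => h a b hab)
      have h1 := numClasses_cyc_mul_swap_of_not hnot
      have h2 := numClasses_anti (cyc_mul_swap_le hle hij)
      have h3 := numClasses_le s
      omega
    subst hs
    refine ⟨[], by simp, rfl, ?_⟩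
    rw [hnull.eq_zero, translation_zero_mul_permIsometry_one, List.prod_nil]
  | succ N ih =>
    -- If `cyc π = s`, split, which raises both counts by one. Otherwise merge two cycles in one
    -- block and keep `s`; the offset is then irrelevant, so `k = 0` is taken.
    obtain ⟨i, j, hij, k, t, ht, hlet, hNt⟩ : ∃ i j : Fin n, i ≠ j ∧ ∃ (k : ℤ) (t : Setoid (Fin n)),
        Null (lam + ((k : ℝ) - (lam : EuclideanSpace ℝ (Fin n)) i +
          (lam : EuclideanSpace ℝ (Fin n)) j) • rootVec i j) t ∧ cyc (π * swap i j) ≤ t ∧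
          n + numClasses (cyc (π * swap i j)) = N + 2 * numClasses t := by
      by_cases hcs : cyc π = s
      · subst hcs
        have hπ : π ≠ 1 := by
          rintro rfl
          rw [cyc_one, numClasses_bot] at hN
          omega
        obtain ⟨i, j, hij, k, hk, hc⟩ := exists_split hl hnull hπ
        exact ⟨i, j, hij, k, _, hk, le_rfl, by omega⟩
      · obtain ⟨i, j, hij, hnot⟩ : ∃ i j, s i j ∧ ¬ cyc π i j := by
          by_contra! h
          exact hcs (le_antisymm hle fun a b hab => h a b hab)
        have h1 := numClasses_cyc_mul_swap_of_not hnot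
        exact ⟨i, j, by rintro rfl; exact hnot ((cyc π).refl i), 0, s,
          null_add_smul_rootVec hnull hij _, cyc_mul_swap_le hle hij, by omega⟩
    obtain ⟨rs, hrs, hlen, hprod⟩ := ih (add_smul_rootVec_mem hl hij k) _ t ht hlet hNt
    refine ⟨affineReflection (rootVec i j) k :: rs, ?_, by rw [List.length_cons, hlen], ?_⟩
    · intro r hr
      rcases List.mem_cons.1 hr with rfl | hr
      · exact affineReflection_mem hij k
      · exact hrs r hr
    · rw [List.prod_cons, hprod, ← affineReflection_mul_normalForm hij, ← mul_assoc,
        affineReflection_mul_self hij, one_mul]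

theorem exists_list_of_mem_affineSymmetricGroup {n : ℕ} (w : affineSymmetricGroup n) :
    ∃ rs : List (Isom n), (∀ r ∈ rs, r ∈ reflections n) ∧ rs.prod = w := by
  obtain ⟨w, hw⟩ := w
  induction hw using Subgroup.closure_induction with
  | mem r hr => exact ⟨[r], by simpa using hr, by simp⟩
  | one => exact ⟨[], by simp, rfl⟩
  | mul a b _ _ ha hb =>
    obtain ⟨rs, hrs, ha⟩ := ha
    obtain ⟨rs', hrs', hb⟩ := hb
    refine ⟨rs ++ rs', fun r hr => (List.mem_append.1 hr).elim (hrs r) (hrs' r), ?_⟩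
    rw [List.prod_append, ha, hb]
  | inv a _ ha =>
    obtain ⟨rs, hrs, ha⟩ := ha
    refine ⟨(rs.map (·⁻¹)).reverse, fun r hr => ?_, by rw [← List.prod_inv_reverse, ha]⟩
    obtain ⟨r', hr', rfl⟩ := List.mem_map.1 (List.mem_reverse.1 hr)
    obtain ⟨i, j, hij, k, rfl⟩ := mem_reflections_iff.1 (hrs r' hr')
    rw [inv_eq_of_mul_eq_one_left (affineReflection_mul_self hij k)]
    exact affineReflection_mem hij k

/-- Every element of the affine symmetric group has a normal form. -/
theorem exists_normalForm {n : ℕ} (w : affineSymmetricGroup n) :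
    ∃ (lam : rootLattice n) (π : Perm (Fin n)), IsNormalForm w lam π := by
  obtain ⟨rs, hrs, hw⟩ := exists_list_of_mem_affineSymmetricGroup w
  obtain ⟨lam, hl, π, hprod, -⟩ := exists_normalForm_of_prod rs hrs
  exact ⟨⟨lam, hl⟩, π, hw.symm.trans hprod⟩

/-- The reflection length in terms of the normal form. -/
theorem reflectionLength_eq {n : ℕ} (w : affineSymmetricGroup n) {lam : rootLattice n}
    {π : Perm (Fin n)} (h : IsNormalForm w lam π) :
    (reflectionLength w : ℤ) =
      n - 2 * relativeNullity (lam : V n) π + numClasses (cyc π) := by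
  obtain ⟨s, hnull, hle, hs⟩ := exists_numClasses_eq_relativeNullity (lam : V n) π
  have h1 := numClasses_anti hle
  have h2 := numClasses_le s
  -- The natural subtraction is not truncated, because `|s|` is at most both `n` and `|cyc π|`.
  obtain ⟨rs, hrs, hlen, hprod⟩ := exists_prod_of_normalForm
    (n + numClasses (cyc π) - 2 * numClasses s) lam.2 π s hnull hle (by omega)
  have hmem : n + numClasses (cyc π) - 2 * numClasses s ∈ {k | ∃ rs : List (Isom n),
      (∀ r ∈ rs, r ∈ reflections n) ∧ rs.length = k ∧ rs.prod = w} :=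
    ⟨rs, hrs, hlen, hprod.trans h.symm⟩
  have hupper : reflectionLength w ≤ _ := Nat.sInf_le hmem
  obtain ⟨rs', hrs', hlen', hprod'⟩ : ∃ rs : List (Isom n), (∀ r ∈ rs, r ∈ reflections n) ∧
    rs.length = reflectionLength w ∧ rs.prod = w := Nat.sInf_mem ⟨_, hmem⟩
  obtain ⟨mu, -, σ, hnf, t, ht, hlet, hcard⟩ := exists_normalForm_of_prod rs' hrs'
  -- Uniqueness of the normal form makes the relation `t` of a shortest word admissible for the
  -- given `λ` and `π`, so `|t| ≤ ν`.
  obtain ⟨rfl, rfl⟩ := normalForm_injective (hnf.symm.trans (hprod'.trans h))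
  have := numClasses_le_relativeNullity ht hlet
  omega

/-! ### Root spaces and dimensions -/

/-- The functions constant on the classes of `s`, parametrized by functions on the quotient. -/
noncomputable def invariantMap {n : ℕ} (s : Setoid (Fin n)) :
    (Quotient s → ℝ) →ₗ[ℝ] EuclideanSpace ℝ (Fin n) where
  toFun g := WithLp.toLp 2 fun i => g (Quotient.mk s i)
  map_add' f g := by ext i; simp
  map_smul' c f := by ext i; simp

theorem invariantMap_injective {n : ℕ} (s : Setoid (Fin n)) :
    Function.Injective (invariantMap s) := by
  intro f g h
  ext q
  obtain ⟨i, rfl⟩ := Quotient.exists_rep q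
  exact congrArg (fun v : EuclideanSpace ℝ (Fin n) => v i) h

/-- The root space of vectors of `V` whose coordinates sum to zero on each class of `s`. -/
noncomputable def nullSpace {n : ℕ} (s : Setoid (Fin n)) : Submodule ℝ (V n) :=
  (LinearMap.range (invariantMap s))ᗮ.comap (V n).subtype

theorem mem_orthogonal_range_invariantMap {n : ℕ} {s : Setoid (Fin n)}
    {v : EuclideanSpace ℝ (Fin n)} : v ∈ (LinearMap.range (invariantMap s))ᗮ ↔
      ∀ g : Fin n → ℝ, (∀ a b, s a b → g a = g b) → ∑ i, v i * g i = 0 := by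
  rw [Submodule.mem_orthogonal]
  constructor
  · intro h g hg
    have := h _ ⟨Quotient.lift g hg, rfl⟩
    rw [PiLp.inner_apply] at this
    simpa [invariantMap] using this
  · rintro h _ ⟨g, rfl⟩
    have := h (fun i => g (Quotient.mk s i)) fun a b hab => congrArg g (Quotient.sound hab)
    rw [PiLp.inner_apply]
    simpa [invariantMap] using this

theorem mem_nullSpace {n : ℕ} {s : Setoid (Fin n)} {v : V n} : v ∈ nullSpace s ↔ Null v s :=
  mem_orthogonal_range_invariantMap

/-- Functions constant on classes form a space of dimension `|s|`. Its orthogonal complement in `ℝⁿ`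
already lies in `V`, as the constant function `1` is among them. -/
theorem finrank_nullSpace {n : ℕ} (s : Setoid (Fin n)) :
    Module.finrank ℝ (nullSpace s) + numClasses s = n := by
  have hle : (LinearMap.range (invariantMap s))ᗮ ≤ V n := by
    intro v hv
    have := mem_orthogonal_range_invariantMap.1 hv (fun _ => 1) fun _ _ _ => rfl
    simp only [mul_one] at this
    exact this
  have h1 := Submodule.finrank_add_finrank_orthogonal (LinearMap.range (invariantMap s))
  have := Fintype.ofFinite (Quotient s)
  rw [LinearMap.finrank_range_of_inj (invariantMap_injective s), Module.finrank_fintype_fun_eq_card,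
    finrank_euclideanSpace_fin] at h1
  rw [nullSpace, (Submodule.comapSubtypeEquivOfLe hle).finrank_eq, numClasses,
    Nat.card_eq_fintype_card]
  omega

theorem rootVec_mem_nullSpace {n : ℕ} {s : Setoid (Fin n)} {i j : Fin n} :
    rootVec i j ∈ nullSpace s ↔ s i j := by
  classical
  rw [mem_nullSpace]
  constructor
  · intro h
    have := h (fun x => if s x j then 1 else 0) fun a b hab => by
      have : s a j ↔ s b j := ⟨s.trans (s.symm hab), s.trans hab⟩
      simp only [this]
    rw [sum_rootVec_mul, if_pos (s.refl j), sub_eq_zero] at this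
    by_contra hc
    rw [if_neg hc] at this
    exact zero_ne_one this
  · intro h g hg
    rw [sum_rootVec_mul, hg i j h, sub_self]

theorem nullSpace_le_span {n : ℕ} (s : Setoid (Fin n)) :
    nullSpace s ≤ Submodule.span ℝ ((nullSpace s : Set (V n)) ∩ roots n) := by
  intro v hv
  set rep : Fin n → Fin n := fun i => (Quotient.mk s i).out with hrep
  have hrs : ∀ i, s i (rep i) := fun i => s.symm (Quotient.mk_out i)
  -- Subtracting `v_i e_{rep i}` for all `i` changes nothing, since at each representative these
  -- terms add up to a class sum of `v`, which is zero.
  have hsum : v = ∑ i, (v : EuclideanSpace ℝ (Fin n)) i • rootVec i (rep i) := by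
    ext x
    have h0 := mem_nullSpace.1 hv (fun i => if x = rep i then 1 else 0) fun a b hab => by
      simp only [hrep, Quotient.sound hab]
    simp only [AddSubmonoidClass.coe_finsetSum, WithLp.ofLp_sum, Finset.sum_apply,
      Submodule.coe_smul, PiLp.smul_apply, rootVec_apply, smul_eq_mul, mul_sub,
      Finset.sum_sub_distrib]
    rw [h0]
    simp
  rw [hsum]
  refine Submodule.sum_mem _ fun i _ => Submodule.smul_mem _ _ ?_
  by_cases hi : i = rep i
  · have : rootVec i (rep i) = 0 := by
      rw [← hi]; ext x; simp [rootVec_apply]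
    rw [this]
    exact zero_mem _
  · exact Submodule.subset_span ⟨rootVec_mem_nullSpace.2 (hrs i), rootVec_mem_roots hi⟩

theorem isRootSpace_nullSpace {n : ℕ} (s : Setoid (Fin n)) : IsRootSpace (nullSpace s) :=
  le_antisymm (nullSpace_le_span s) (Submodule.span_le.2 Set.inter_subset_left)

/-- The relation `e_i - e_j ∈ U` is an equivalence because `U` is closed under sums and negation; a
root space is determined by the roots it contains. -/
theorem exists_eq_nullSpace {n : ℕ} {U : Submodule ℝ (V n)} (hU : IsRootSpace U) :
    ∃ s : Setoid (Fin n), U = nullSpace s := by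
  have hself : ∀ i : Fin n, rootVec i i = 0 := fun i => by ext x; simp [rootVec_apply]
  have hneg : ∀ i j : Fin n, rootVec j i = -rootVec i j := fun i j => by
    ext x; simp [rootVec_apply]
  have hadd : ∀ i j k : Fin n, rootVec i k = rootVec i j + rootVec j k := fun i j k => by
    ext x; simp [rootVec_apply]
  let s : Setoid (Fin n) :=
    { r := fun i j => rootVec i j ∈ U
      iseqv :=
        ⟨fun i => by rw [hself]; exact zero_mem _,
         fun {i j} h => by rw [hneg i j]; exact neg_mem h,
         fun {i j k} h h' => by rw [hadd i j k]; exact add_mem h h'⟩ }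
  refine ⟨s, le_antisymm ?_ ?_⟩
  · rw [hU, Submodule.span_le]
    rintro α ⟨hα, hr⟩
    obtain ⟨i, j, -, rfl⟩ := mem_roots_iff.1 hr
    exact rootVec_mem_nullSpace.2 hα
  · refine (nullSpace_le_span s).trans (Submodule.span_le.2 ?_)
    rintro α ⟨hα, hr⟩
    obtain ⟨i, j, -, rfl⟩ := mem_roots_iff.1 hr
    exact rootVec_mem_nullSpace.1 hα

theorem moveSet_subset_iff {n : ℕ} (lam : V n) (π : Perm (Fin n)) (s : Setoid (Fin n)) :
    moveSet (translation lam * permIsometry π) ⊆ nullSpace s ↔ Null lam s ∧ cyc π ≤ s := by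
  constructor
  · intro h
    have hlam : lam ∈ nullSpace s := h ⟨0, by ext x; rw [normalForm_apply]; simp⟩
    refine ⟨mem_nullSpace.1 hlam, ?_⟩
    rw [cyc_le_iff]
    intro a
    have hn : (n : ℝ) ≠ 0 := Nat.cast_ne_zero.2 a.pos.ne'
    -- This is the projection of `e_{π a}` to `V`; the isometry moves it by `λ + e_a - e_{π a}`.
    let x : V n := ⟨WithLp.toLp 2 fun y => (if y = π a then 1 else 0) - (n : ℝ)⁻¹, by
      change ∑ y : Fin n, ((if y = π a then (1 : ℝ) else 0) - (n : ℝ)⁻¹) = 0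
      simp [hn]⟩
    have hx : ∀ y, (x : EuclideanSpace ℝ (Fin n)) y =
      (if y = π a then 1 else 0) - (n : ℝ)⁻¹ := fun y => rfl
    have hmem : lam + rootVec a (π a) ∈ nullSpace s := h ⟨x, by
      ext y
      rw [normalForm_apply]
      simp only [Submodule.coe_add, PiLp.add_apply, hx, rootVec_apply, π.injective.eq_iff]
      ring⟩
    exact s.symm (rootVec_mem_nullSpace.1 ((Submodule.add_mem_iff_right _ hlam).1 hmem))
  · rintro ⟨hlam, hle⟩ μ ⟨x, hx⟩
    refine mem_nullSpace.2 fun g hg => ?_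
    have hμ : ∀ i, (μ : EuclideanSpace ℝ (Fin n)) i = (lam : EuclideanSpace ℝ (Fin n)) i +
        ((x : EuclideanSpace ℝ (Fin n)) (π i) - (x : EuclideanSpace ℝ (Fin n)) i) := fun i => by
      have := congrArg (fun v : V n => (v : EuclideanSpace ℝ (Fin n)) i) hx
      simp only [normalForm_apply, Submodule.coe_add, PiLp.add_apply] at this
      linarith
    -- A test function constant on the cycles is `π`-invariant, so the linear part of the
    -- displacement pairs to zero with it.
    have hperm : ∑ i, (x : EuclideanSpace ℝ (Fin n)) (π i) * g i =
        ∑ i, (x : EuclideanSpace ℝ (Fin n)) i * g i := by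
      rw [← Equiv.sum_comp π fun i => (x : EuclideanSpace ℝ (Fin n)) i * g i]
      refine Finset.sum_congr rfl fun i _ => ?_
      rw [hg _ _ (cyc_le_iff.1 hle i)]
    simp only [hμ, add_mul, sub_mul, Finset.sum_add_distrib, Finset.sum_sub_distrib]
    rw [hperm, hlam g hg]
    ring

/-- A smallest root space containing the move-set corresponds to an admissible relation with the
most classes. -/
theorem isomDim_normalForm {n : ℕ} (lam : V n) (π : Perm (Fin n)) :
    isomDim (translation lam * permIsometry π) + relativeNullity lam π = n := by
  obtain ⟨s, hnull, hle, hs⟩ := exists_numClasses_eq_relativeNullity lam π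
  have hfs := finrank_nullSpace s
  have hmem : Module.finrank ℝ (nullSpace s) ∈ {k | ∃ U : Submodule ℝ (V n), IsRootSpace U ∧
      moveSet (translation lam * permIsometry π) ⊆ U ∧ Module.finrank ℝ U = k} :=
    ⟨_, isRootSpace_nullSpace s, (moveSet_subset_iff lam π s).2 ⟨hnull, hle⟩, rfl⟩
  have hupper : isomDim (translation lam * permIsometry π) ≤ _ := Nat.sInf_le hmem
  obtain ⟨U, hU, hmove, hdim⟩ : ∃ U : Submodule ℝ (V n), IsRootSpace U ∧
      moveSet (translation lam * permIsometry π) ⊆ U ∧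
        Module.finrank ℝ U = isomDim (translation lam * permIsometry π) :=
    Nat.sInf_mem ⟨_, hmem⟩
  obtain ⟨t, rfl⟩ := exists_eq_nullSpace hU
  obtain ⟨ht, hlet⟩ := (moveSet_subset_iff lam π t).1 hmove
  have hft := finrank_nullSpace t
  have := numClasses_le_relativeNullity ht hlet
  omega

theorem ellipticPart_normalForm {n : ℕ} (lam : V n) (π : Perm (Fin n)) :
    ellipticPart (translation lam * permIsometry π) = translation 0 * permIsometry π := by
  ext v x
  have h := (translation lam * permIsometry π).map_vsub v 0
  rw [vsub_eq_sub, vsub_eq_sub, sub_zero] at h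
  change ((translation lam * permIsometry π).linearIsometryEquiv v : EuclideanSpace ℝ (Fin n)) x = _
  rw [h, Submodule.coe_sub, PiLp.sub_apply, normalForm_apply, normalForm_apply, normalForm_apply]
  simp

end AffineSymmetric

theorem mainTheorem3 (n : ℕ) (w : AffineSymmetric.affineSymmetricGroup n) :
    (∃! p : AffineSymmetric.rootLattice n × Equiv.Perm (Fin n),
      AffineSymmetric.IsNormalForm w p.1 p.2) ∧
    ∀ (lam : AffineSymmetric.rootLattice n) (π : Equiv.Perm (Fin n)),
      AffineSymmetric.IsNormalForm w lam π →
        (AffineSymmetric.ellipticDim w : ℤ) = n - AffineSymmetric.numCycles π ∧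
        AffineSymmetric.differentialDim w =
          AffineSymmetric.numCycles π - AffineSymmetric.relativeNullity (lam : AffineSymmetric.V n) π ∧
        (AffineSymmetric.reflectionLength w : ℤ) =
          n - 2 * AffineSymmetric.relativeNullity (lam : AffineSymmetric.V n) π
            + AffineSymmetric.numCycles π := by
  constructor
  · obtain ⟨lam, π, h⟩ := AffineSymmetric.exists_normalForm w
    refine ⟨(lam, π), h, fun q hq => ?_⟩
    obtain ⟨h1, h2⟩ := AffineSymmetric.normalForm_injective (hq.symm.trans h)
    exact Prod.ext (Subtype.ext h1) h2
  · intro lam π h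
    have hw : (w : AffineSymmetric.Isom n) =
      AffineSymmetric.translation (lam : AffineSymmetric.V n) * AffineSymmetric.permIsometry π := h
    have hdim := AffineSymmetric.isomDim_normalForm (lam : AffineSymmetric.V n) π
    have hell := AffineSymmetric.isomDim_normalForm (0 : AffineSymmetric.V n) π
    rw [AffineSymmetric.relativeNullity_zero, ← AffineSymmetric.ellipticPart_normalForm lam,
      ← hw] at hell
    rw [← hw] at hdim
    have hlen := AffineSymmetric.reflectionLength_eq w h
    have he : AffineSymmetric.ellipticDim w =
      AffineSymmetric.isomDim (AffineSymmetric.ellipticPart (w : AffineSymmetric.Isom n)) := rfl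
    rw [AffineSymmetric.numCycles_eq, AffineSymmetric.differentialDim, he]
    exact ⟨by omega, by omega, hlen⟩
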